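/- Let $\mathcal S\subset\mathbb Z^2$ be a finite set of steps $s=(|s|,\mathrm{alt}(s))$, all of positive length $|s|>0$. Let a finite automaton with alphabet $\mathcal S$, finite state set $\mathcal M=\{X_1,\dots,X_\ell\}$, initial state $X_1$, possibly partial transition function $\delta$ and no final states be given. Lattice paths are finite words over $\mathcal S$ that the automaton can read from $X_1$ (all transitions being defined); the length and the final altitude of a path are the sums of the lengths and altitudes of its steps. A meander is such a path none of whose prefixes has negative altitude, and an excursion is a meander of final altitude $0$. Let $E(t)$ be the generating function of excursions by length, and let $M(t,u)$ (respectively $M_i(t,u)$) be the generating function of meanders (respectively of meanders ending in state $X_i$), where $t$ encodes length and $u$ encodes final altitude. Let $A(t,u)$ be the adjacency matrix, $A_{ij}=\sum_{s:\,\delta(X_i,s)=X_j}t^{|s|}u^{\mathrm{alt}(s)}$, let $K(t,u)=\det(I-A(t,u))$ be the kernel, and let $u_1(t),\dots,u_e(t)$ be its small roots, i.e. the nonzero roots $u$ of $K(t,u)$ in the algebraic closure of $\mathbb C((t))$ (the field of Puiseux series) that tend to $0$ as $t\to0$, listed with multiplicity. Put $$F=(1,0,\dots,0)-\{u^{<0}\}\big((M_1,\dots,M_\ell)A(t,u)\big),\qquad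 \vec v=\mathrm{adj}(I-A(t,u))\vec{\mathbf 1},\qquad \Phi(t,u)=u^eF\vec v,$$ where $\{u^{<0}\}$ extracts the terms with negative powers of $u$. Then there is a unique polynomial $G(t,u)$ in $u$, with formal power series in $t$ as coefficients, such that $\Phi(t,u)=G(t,u)\prod_{i=1}^e(u-u_i(t))$. Moreover $u^eK(t,u)$ is a polynomial in $u$ that does not vanish at $u=0$, one has $$M(t,u)=\frac{G(t,u)}{u^eK(t,u)}\prod_{i=1}^e(u-u_i(t)),$$ and the generating function of excursions satisfies $$E(t)=M(t,0)=\left.\frac{G(t,u)}{u^eK(t,u)}\prod_{i=1}^e(u-u_i(t))\right|_{u=0}.$$ -/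

import Mathlib

noncomputable section

namespace LatticePath

open Polynomial LaurentPolynomial

/-! ### Lattice paths -/

/-- A lattice path with step set `S` is a finite word in the steps. A step is a pair
(length, altitude). -/
abbrev Path (S : Finset (ℤ × ℤ)) : Type := List S

/-- The length of a path: the sum of the first coordinates of its steps. -/
def len {S : Finset (ℤ × ℤ)} (w : Path S) : ℤ := (w.map fun s => s.1.1).sum

/-- The final altitude of a path: the sum of the second coordinates of its steps. -/
def alt {S : Finset (ℤ × ℤ)} (w : Path S) : ℤ := (w.map fun s => s.1.2).sum

/-- A meander never attains negative altitude. -/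
def IsMeander {S : Finset (ℤ × ℤ)} (w : Path S) : Prop := ∀ w', w' <+: w → 0 ≤ alt w'

/-- An excursion is a meander that ends on the `x`-axis. -/
def IsExcursion {S : Finset (ℤ × ℤ)} (w : Path S) : Prop := IsMeander w ∧ alt w = 0

/-! ### Automata -/

/-- A finite automaton without final states, with alphabet `α` and state set `Q`, whose transition
function may be partial (`none` means "undefined"). -/
structure Automaton (α Q : Type*) where
  init : Q
  step : Q → α → Option Q

/-- The state reached from `q` after reading the word `w`, if all transitions are defined. -/
def Automaton.run {α Q : Type*} (𝒜 : Automaton α Q) : Q → List α → Option Q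
  | q, [] => some q
  | q, a :: w => (𝒜.step q a).bind fun q' => 𝒜.run q' w

/-- The ring of formal power series in the length variable `t`. -/
abbrev R : Type := PowerSeries ℂ

/-- An algebraic closure of the field of formal Laurent series in `t`; by the Newton-Puiseux
theorem this is the field of Puiseux series in `t`. -/
abbrev L : Type := AlgebraicClosure (LaurentSeries ℂ)

/-- `x` tends to `0` as `t` tends to `0`: some power `x ^ N`, `N ≥ 1`, is `t` times an element which
has no pole at `t = 0` (which is integral over the power series in `t`). Equivalently, the
extension of the `t`-adic valuation to `L` is positive at `x`. -/
def IsSmall (x : L) : Prop :=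
  ∃ N : ℕ, 1 ≤ N ∧ ∃ w : L, IsIntegral R w ∧ x ^ N = algebraMap R L PowerSeries.X * w

/-- The roots in `L \ {0}`, with multiplicity, of a Laurent polynomial `f` in `u`: the nonzero roots
of `u ^ n * f` for any `n` for which this is a polynomial. -/
def laurentRoots (f : R[T;T⁻¹]) : Multiset L := by
  classical
  exact (((f.exists_T_pow).choose_spec.choose).map (algebraMap R L)).roots.filter (· ≠ 0)

/-- A Laurent polynomial in `u`, seen as a formal Laurent series in `u`. -/
def toSeries : R[T;T⁻¹] →+* LaurentSeries R :=
  LaurentPolynomial.eval₂ HahnSeries.C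
    { val := HahnSeries.single 1 1
      inv := HahnSeries.single (-1) 1
      val_inv := by simp
      inv_val := by simp }

namespace Automaton

variable {S : Finset (ℤ × ℤ)} {Q : Type*} [Fintype Q] [DecidableEq Q] (𝒜 : Automaton S Q)

/-- The paths which the automaton can read from its initial state. -/
def Accepts {S : Finset (ℤ × ℤ)} {Q : Type*} (𝒜 : Automaton S Q) (w : Path S) : Prop :=
  ∃ q, 𝒜.run 𝒜.init w = some q

/-- The generating function `E(t)` of the excursions read by the automaton. -/
def excursionGF {S : Finset (ℤ × ℤ)} {Q : Type*} (𝒜 : Automaton S Q) : R :=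
  PowerSeries.mk fun n => (Set.ncard {w : Path S | 𝒜.Accepts w ∧ IsExcursion w ∧ len w = n} : ℂ)

/-- The bivariate generating function `M(t,u)` of the meanders read by the automaton; a power
series in `u` whose coefficients are power series in `t`. -/
def meanderGF {S : Finset (ℤ × ℤ)} {Q : Type*} (𝒜 : Automaton S Q) : PowerSeries R :=
  PowerSeries.mk fun k => PowerSeries.mk fun n =>
    (Set.ncard {w : Path S | 𝒜.Accepts w ∧ IsMeander w ∧ len w = n ∧ alt w = k} : ℂ)

/-- The generating function `M_q(t,u)` of the meanders ending in state `q`. -/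
def meanderGFAt {S : Finset (ℤ × ℤ)} {Q : Type*} (𝒜 : Automaton S Q) (q : Q) : PowerSeries R :=
  PowerSeries.mk fun k => PowerSeries.mk fun n =>
    (Set.ncard {w : Path S |
      𝒜.run 𝒜.init w = some q ∧ IsMeander w ∧ len w = n ∧ alt w = k} : ℂ)

/-- The adjacency matrix `A(t,u)`: the entry `(i, j)` is the sum of `t ^ |s| * u ^ alt s` over the
steps `s` leading from state `i` to state `j`. -/
def adjacency : Matrix Q Q R[T;T⁻¹] := Matrix.of fun i j =>
  ∑ s : S, if 𝒜.step i s = some j then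
    LaurentPolynomial.C (PowerSeries.X ^ s.1.1.toNat) * T s.1.2 else 0

/-- The kernel `K(t,u) = det (I - A(t,u))`. -/
def kernel : R[T;T⁻¹] := (1 - 𝒜.adjacency).det

/-- The small roots `u_1(t), …, u_e(t)` of the kernel, with multiplicity. -/
def smallRoots : Multiset L := by
  classical
  exact (laurentRoots 𝒜.kernel).filter IsSmall

/-- The number `e` of small roots. -/
def numSmall : ℕ := Multiset.card 𝒜.smallRoots

/-- The product `∏ (u - u_i(t))` over the small roots. -/
def smallProd : L[X] := (𝒜.smallRoots.map fun r => Polynomial.X - Polynomial.C r).prod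

/-- The vector `F = (1,0,…,0) - {u^{<0}} ((M_1,…,M_ℓ) A(t,u))`, the initial state being the first
one. -/
def forbidden (j : Q) : LaurentSeries R :=
  (if j = 𝒜.init then 1 else 0) -
    HahnSeries.truncLT 0
      (∑ i, HahnSeries.ofPowerSeries ℤ R (𝒜.meanderGFAt i) * toSeries (𝒜.adjacency i j))

/-- The vector `v = adj (I - A(t,u)) (1,…,1)ᵀ`. -/
def autocorrelation : Q → R[T;T⁻¹] := (1 - 𝒜.adjacency).adjugate.mulVec 1

/-- `Φ(t,u) = u^e (F_1,…,F_ℓ) v`. -/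
def Phi : LaurentSeries R :=
  HahnSeries.single (𝒜.numSmall : ℤ) 1 * ∑ j, 𝒜.forbidden j * toSeries (𝒜.autocorrelation j)

/-- `G(t,u)` is the cofactor of `∏ (u - u_i(t))` in `Φ`: a polynomial in `u`, with formal power
series in `t` as coefficients, such that `Φ(t,u) = G(t,u) ∏ (u - u_i(t))`. -/
def IsCofactor (G : R[X]) : Prop :=
  𝒜.Phi.map (algebraMap R L) =
    HahnSeries.ofPowerSeries ℤ L ((G.map (algebraMap R L) * 𝒜.smallProd : L[X]) : PowerSeries L)

end Automaton

/-- If all steps have positive length, there are finitely many paths of a given length. -/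
theorem finite_len_eq {S : Finset (ℤ × ℤ)} (hS : ∀ s ∈ S, 0 < s.1) (n : ℕ) :
    {w : Path S | len w = n}.Finite := by
  refine (List.finite_length_le S n).subset fun w hw => ?_
  have key : ∀ w : Path S, (w.length : ℤ) ≤ len w := by
    intro w
    induction w with
    | nil => simp [len]
    | cons s w ih =>
      have := hS s.1 s.2
      simp only [len, List.map_cons, List.sum_cons, List.length_cons] at ih ⊢
      push_cast
      linarith
  have h1 := key w
  have h2 : len w = n := hw
  simp only [Set.mem_ofPred_eq]
  omega

end LatticePath

end

noncomputable section

namespace LatticePath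

open Polynomial LaurentPolynomial

/-! This is the kernel method, with Weierstrass preparation in place of Puiseux expansions. Removing
the last step of a meander gives `(M_i)(I - A) = F` (`ncard_meandersTo`, `forbidden_eq`).
Multiplying by `adj(I - A)1` turns this into `Φ = D M`, where `D = u^e K` (`Phi_eq`).

Since every step has positive length, `K ≡ 1` mod `t`, so `D ≡ u^e`. Weierstrass preparation over
`ℂ[[t]]` then gives `D = f q` with `f` distinguished of degree `e` and `q ≡ 1` mod `t`. Every root
of `f` is small and no root of `q` is, so `f = ∏ (u - u_i)` (`exists_kernel_factorization`).

Finally, `Φ` is both a Laurent polynomial in `u` (`F` has no positive powers) and a power series in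
`u`, hence a polynomial. As `Φ = f · (q M)`, uniqueness of Weierstrass division makes `q M` a
polynomial: this is `G`. Dividing by `D` and setting `u = 0` gives the formulas for `M` and `E`. -/

/-! ### Weierstrass division and preparation for polynomials -/

theorem exists_coe_eq_of_isDistinguishedAt {A : Type*} [CommRing A] {I : Ideal A} [IsHausdorff I A]
    (hI : I ≠ ⊤) {f : A[X]} (hf : f.IsDistinguishedAt I) {p : A[X]} {h : PowerSeries A}
    (hp : (p : PowerSeries A) = f * h) : ∃ q : A[X], (q : PowerSeries A) = h := by
  have hdeg : ((f : PowerSeries A).map (Ideal.Quotient.mk I)).order.toNat = f.natDegree := by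
    have := hf.coe_natDegree_eq_order_map (f : PowerSeries A) 1
      (by rwa [map_one, ← Ideal.ne_top_iff_one]) (by simp)
    rw [← this]; rfl
  have : Nontrivial A := ⟨0, 1, fun h => hI ((Ideal.eq_top_iff_one I).2 (h ▸ I.zero_mem))⟩
  -- Euclidean division by the monic `f` is also a Weierstrass division, and so is `p = f * h + 0`;
  -- by uniqueness the quotients agree.
  refine ⟨p /ₘ f, ((hf.isWeierstrassDivisorAt hI).eq_of_mul_add_eq_mul_add (r := p %ₘ f) (r' := 0)
    ?_ ?_ ?_).1⟩
  · rw [hdeg, ← Polynomial.degree_eq_natDegree hf.monic.ne_zero]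
    exact Polynomial.degree_modByMonic_lt _ hf.monic
  · simp
  · rw [Polynomial.coe_zero, add_zero, ← hp, ← Polynomial.coe_mul, ← Polynomial.coe_add, add_comm,
      Polynomial.modByMonic_add_div]

instance : IsAdicComplete (IsLocalRing.maximalIdeal R) R := by
  rw [PowerSeries.maximalIdeal_eq_span_X]
  infer_instance

theorem mem_maximalIdeal_iff {a : R} :
    a ∈ IsLocalRing.maximalIdeal R ↔ PowerSeries.constantCoeff a = 0 := by
  rw [PowerSeries.maximalIdeal_eq_span_X, Ideal.mem_span_singleton, PowerSeries.X_dvd_iff]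

theorem map_constantCoeff_of_isDistinguishedAt {f : R[X]}
    (hf : f.IsDistinguishedAt (IsLocalRing.maximalIdeal R)) :
    f.map PowerSeries.constantCoeff = Polynomial.X ^ f.natDegree := by
  ext i
  rw [Polynomial.coeff_map, Polynomial.coeff_X_pow]
  split_ifs with h
  · simp [h, hf.monic]
  · rcases lt_or_gt_of_ne h with lt | gt
    · exact mem_maximalIdeal_iff.1 (hf.mem lt)
    · simp [Polynomial.coeff_eq_zero_of_natDegree_lt gt]

theorem exists_distinguished_mul {D : R[X]} {e : ℕ}
    (hD : D.map PowerSeries.constantCoeff = Polynomial.X ^ e) :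
    ∃ f q : R[X], D = f * q ∧ f.IsDistinguishedAt (IsLocalRing.maximalIdeal R) ∧
      f.natDegree = e ∧ q.map PowerSeries.constantCoeff = 1 := by
  have hne : (D : PowerSeries R).map (IsLocalRing.residue R) ≠ 0 := by
    intro h
    have h1 := congrArg (PowerSeries.coeff e) h
    rw [PowerSeries.coeff_map, Polynomial.coeff_coe, map_zero, IsLocalRing.residue_eq_zero_iff,
      mem_maximalIdeal_iff, ← Polynomial.coeff_map, hD] at h1
    simp at h1
  obtain ⟨f, h, H⟩ := PowerSeries.exists_isWeierstrassFactorization hne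
  obtain ⟨q, rfl⟩ := exists_coe_eq_of_isDistinguishedAt (Ideal.IsPrime.ne_top inferInstance)
    H.isDistinguishedAt H.eq_mul
  have hDf : D = f * q := by
    have := H.eq_mul
    rwa [← Polynomial.coe_mul, Polynomial.coe_inj] at this
  have hq0 : (q.map (PowerSeries.constantCoeff (R := ℂ))).coeff 0 ≠ 0 := by
    have := (H.isUnit.map (PowerSeries.constantCoeff (R := R))).map
      (PowerSeries.constantCoeff (R := ℂ))
    simpa using this.ne_zero
  have hmul : (Polynomial.X : ℂ[X]) ^ e =
      Polynomial.X ^ f.natDegree * q.map PowerSeries.constantCoeff := by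
    rw [← hD, hDf, Polynomial.map_mul, map_constantCoeff_of_isDistinguishedAt H.isDistinguishedAt]
  -- The reduction of `q` has nonzero constant term, so `X ^ f.natDegree` is the exact power of `X`
  -- dividing the right side of `hmul`.
  have hle : f.natDegree = e := by
    have := congrArg (fun p => Polynomial.coeff p f.natDegree) hmul
    simp only [Polynomial.coeff_X_pow, Polynomial.coeff_X_pow_mul', le_refl, if_true,
      Nat.sub_self] at this
    by_contra hh
    rw [if_neg hh] at this
    exact hq0 this.symm
  refine ⟨f, q, hDf, H.isDistinguishedAt, hle, ?_⟩
  rw [hle] at hmul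
  exact (mul_left_cancel₀ (pow_ne_zero _ Polynomial.X_ne_zero) (by rw [mul_one]; exact hmul)).symm

theorem exists_eq_C_X_mul {p : R[X]} (hp : p.map PowerSeries.constantCoeff = 0) :
    ∃ g : R[X], p = Polynomial.C PowerSeries.X * g := by
  refine (Polynomial.C_dvd_iff_dvd_coeff _ _).2 fun i => ?_
  rw [PowerSeries.X_dvd_iff, ← Polynomial.coeff_map, hp, Polynomial.coeff_zero]

/-! ### Small and non-small roots -/

theorem algebraMap_R_L_injective : Function.Injective (algebraMap R L) := by
  rw [IsScalarTower.algebraMap_eq R (LaurentSeries ℂ) L]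
  exact (algebraMap (LaurentSeries ℂ) L).injective.comp
    (IsFractionRing.injective R (LaurentSeries ℂ))

theorem isIntegral_eval₂ {x : L} (hx : IsIntegral R x) (g : R[X]) :
    IsIntegral R (g.eval₂ (algebraMap R L) x) := by
  rw [← Polynomial.aeval_def]
  exact Algebra.adjoin_le (S := integralClosure R L) (Set.singleton_subset_iff.2 hx)
    (Polynomial.aeval_mem_adjoin_singleton R x)

/-- Writing `f = X ^ d + t g`, a root satisfies `x ^ d = -t g(x)`, and `g(x)` is integral because
`x` is. -/
theorem isSmall_of_eval₂_eq_zero {f : R[X]}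
    (hf : f.IsDistinguishedAt (IsLocalRing.maximalIdeal R)) {x : L}
    (hx : f.eval₂ (algebraMap R L) x = 0) : IsSmall x := by
  obtain ⟨g, hg⟩ := exists_eq_C_X_mul (p := f - Polynomial.X ^ f.natDegree) (by
    rw [Polynomial.map_sub, map_constantCoeff_of_isDistinguishedAt hf]; simp)
  have hint : IsIntegral R x := ⟨f, hf.monic, hx⟩
  have hdeg : f.natDegree ≠ 0 := by
    intro h0
    rw [hf.monic.natDegree_eq_zero.1 h0] at hx
    simp at hx
  refine ⟨f.natDegree, Nat.one_le_iff_ne_zero.2 hdeg, -g.eval₂ (algebraMap R L) x,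
    (isIntegral_eval₂ hint g).neg, ?_⟩
  have := congrArg (Polynomial.eval₂ (algebraMap R L) x) hg
  simp only [Polynomial.eval₂_sub, hx, Polynomial.eval₂_X_pow, Polynomial.eval₂_mul,
    Polynomial.eval₂_C] at this
  linear_combination -this

/-- A small `x` is integral. Writing `q = 1 + t g`, a root gives `t · (-g(x)) = 1`, so `1/t` would
be integral over the integrally closed ring `ℂ[[t]]`, hence lie in it. -/
theorem not_isSmall_of_eval₂_eq_zero {q : R[X]} (hq : q.map PowerSeries.constantCoeff = 1) {x : L}
    (hx : q.eval₂ (algebraMap R L) x = 0) : ¬ IsSmall x := by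
  rintro ⟨N, hN, w, hw, hxw⟩
  have hint : IsIntegral R x := by
    refine IsIntegral.of_pow hN ?_
    rw [hxw]
    exact isIntegral_algebraMap.mul hw
  obtain ⟨g, hg⟩ := exists_eq_C_X_mul (p := q - 1) (by
    rw [Polynomial.map_sub, hq]; simp)
  have h1 := congrArg (Polynomial.eval₂ (algebraMap R L) x) hg
  simp only [Polynomial.eval₂_sub, hx, Polynomial.eval₂_one, Polynomial.eval₂_mul,
    Polynomial.eval₂_C] at h1
  have hy := (isIntegral_eval₂ hint g).neg
  set y := -g.eval₂ (algebraMap R L) x with hydef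
  have hXy : algebraMap R L PowerSeries.X * y = 1 := by
    rw [hydef, mul_neg, ← h1]; ring
  have hX0 : algebraMap R L PowerSeries.X ≠ 0 := left_ne_zero_of_mul_eq_one hXy
  have hXF : algebraMap R (LaurentSeries ℂ) PowerSeries.X ≠ 0 := by
    intro h
    rw [IsScalarTower.algebraMap_apply R (LaurentSeries ℂ) L, h, map_zero] at hX0
    exact hX0 rfl
  have hyF : y = algebraMap (LaurentSeries ℂ) L
      (algebraMap R (LaurentSeries ℂ) PowerSeries.X)⁻¹ := by
    rw [map_inv₀, ← IsScalarTower.algebraMap_apply R (LaurentSeries ℂ) L]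
    exact (inv_eq_of_mul_eq_one_right hXy).symm
  rw [hyF, isIntegral_algebraMap_iff (algebraMap (LaurentSeries ℂ) L).injective] at hy
  obtain ⟨a, ha⟩ := IsIntegrallyClosed.algebraMap_eq_of_integral hy
  have : (PowerSeries.X : R) * a = 1 := by
    apply IsFractionRing.injective R (LaurentSeries ℂ)
    rw [map_mul, ha, map_one, mul_inv_cancel₀ hXF]
  have h0 := congrArg PowerSeries.constantCoeff this
  simp at h0

/-! ### The small roots of the kernel -/

theorem filter_roots_X_pow_mul {K : Type*} [Field K] [DecidableEq K] {p : K[X]} (n : ℕ)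
    (hp : p ≠ 0) :
    (Polynomial.X ^ n * p).roots.filter (· ≠ 0) = p.roots.filter (· ≠ 0) := by
  rw [Polynomial.roots_mul (mul_ne_zero (pow_ne_zero _ Polynomial.X_ne_zero) hp),
    Polynomial.roots_X_pow, Multiset.filter_add, add_eq_right, Multiset.filter_eq_nil]
  intro a ha
  rw [Multiset.nsmul_singleton] at ha
  simpa using Multiset.eq_of_mem_replicate ha

/-- Two polynomial multiples of `f` by powers of `u` differ only by a power of `u`, so the arbitrary
choice in `laurentRoots` is harmless; `h0` makes the filter on nonzero roots void for `D`. -/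
theorem laurentRoots_eq {f : R[T;T⁻¹]} {D : R[X]} {n : ℤ} (hD : Polynomial.toLaurent D = T n * f)
    (h0 : D.eval 0 ≠ 0) : laurentRoots f = (D.map (algebraMap R L)).roots := by
  classical
  set m := f.exists_T_pow.choose with hm
  set p := f.exists_T_pow.choose_spec.choose with hpdef
  have hp : Polynomial.toLaurent p = f * T m := f.exists_T_pow.choose_spec.choose_spec
  have hD0 : D ≠ 0 := by rintro rfl; simp at h0
  have hp0 : p ≠ 0 := by
    intro h
    rw [h, map_zero] at hp
    have : f = 0 := by
      have := congrArg (· * T (-(m : ℤ))) hp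
      rwa [zero_mul, mul_assoc, ← T_add, add_neg_cancel, T_zero, mul_one, eq_comm] at this
    rw [this, mul_zero] at hD
    exact hD0 ((Polynomial.toLaurent_eq_zero).1 hD)
  have inj := algebraMap_R_L_injective
  have hmn : ∃ a b : ℕ, (Polynomial.X : R[X]) ^ a * p = Polynomial.X ^ b * D := by
    refine ⟨n.toNat, m + (-n).toNat, Polynomial.toLaurent_injective ?_⟩
    rw [map_mul, map_mul, hp, hD, Polynomial.toLaurent_X_pow, Polynomial.toLaurent_X_pow, T_mul,
      mul_assoc, ← T_add, ← mul_assoc, ← T_add, T_mul]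
    congr 2
    push_cast
    omega
  obtain ⟨a, b, hab⟩ := hmn
  have hab' := congrArg (Polynomial.map (algebraMap R L)) hab
  simp only [Polynomial.map_mul, Polynomial.map_pow, Polynomial.map_X] at hab'
  have h1 : laurentRoots f = (p.map (algebraMap R L)).roots.filter (· ≠ 0) := by
    unfold laurentRoots; congr!
  rw [h1, ← filter_roots_X_pow_mul a ((Polynomial.map_ne_zero_iff inj).2 hp0), hab',
    filter_roots_X_pow_mul b ((Polynomial.map_ne_zero_iff inj).2 hD0), Multiset.filter_eq_self]
  rintro x hx rfl
  have := Polynomial.isRoot_of_mem_roots hx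
  rw [Polynomial.IsRoot, Polynomial.eval_zero_map, map_eq_zero_iff _ inj] at this
  exact h0 this

section

variable {S : Finset (ℤ × ℤ)} {Q : Type*} [DecidableEq Q]

theorem smallRoots_eq [Fintype Q] (𝒜 : Automaton S Q) {f q : R[X]} {n : ℤ}
    (hD : Polynomial.toLaurent (f * q) = T n * 𝒜.kernel) (h0 : (f * q).eval 0 ≠ 0)
    (hf : f.IsDistinguishedAt (IsLocalRing.maximalIdeal R))
    (hq : q.map PowerSeries.constantCoeff = 1) :
    𝒜.smallRoots = (f.map (algebraMap R L)).roots := by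
  classical
  have hne : (f * q).map (algebraMap R L) ≠ 0 := by
    rw [Polynomial.map_ne_zero_iff algebraMap_R_L_injective]
    intro h
    simp [h] at h0
  have h1 : 𝒜.smallRoots = (laurentRoots 𝒜.kernel).filter IsSmall := by
    unfold Automaton.smallRoots; congr!
  rw [Polynomial.map_mul] at hne
  rw [h1, laurentRoots_eq hD h0, Polynomial.map_mul, Polynomial.roots_mul hne, Multiset.filter_add,
    Multiset.filter_eq_self.2, Multiset.filter_eq_nil.2, add_zero]
  · intro x hx
    refine not_isSmall_of_eval₂_eq_zero hq ?_
    rw [← Polynomial.eval_map]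
    exact Polynomial.isRoot_of_mem_roots hx
  · intro x hx
    refine isSmall_of_eval₂_eq_zero hf ?_
    rw [← Polynomial.eval_map]
    exact Polynomial.isRoot_of_mem_roots hx

theorem adjacency_mem (hS : ∀ s ∈ S, 0 < s.1) (𝒜 : Automaton S Q) (i j : Q) :
    𝒜.adjacency i j ∈ Ideal.span {(LaurentPolynomial.C (PowerSeries.X : R) : R[T;T⁻¹])} := by
  simp only [Automaton.adjacency, Matrix.of_apply]
  refine Ideal.sum_mem _ fun s _ => ?_
  split_ifs
  · refine Ideal.mul_mem_right _ _ ?_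
    rw [Ideal.mem_span_singleton]
    have := hS s.1 s.2
    exact map_dvd _ (dvd_pow_self _ (by omega))
  · exact Ideal.zero_mem _

theorem det_one_sub_sub_one_mem {A : Type*} [CommRing A] {I : Ideal A} [Fintype Q]
    {M : Matrix Q Q A} (hM : ∀ i j, M i j ∈ I) : (1 - M).det - 1 ∈ I := by
  have h0 : (Ideal.Quotient.mk I).mapMatrix M = 0 := by
    ext i j
    exact Ideal.Quotient.eq_zero_iff_mem.2 (hM i j)
  rw [← Ideal.Quotient.eq_zero_iff_mem, map_sub, map_one, RingHom.map_det, map_sub, h0, map_one,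
    sub_zero, Matrix.det_one, sub_self]

theorem constantCoeff_kernel [Fintype Q] (hS : ∀ s ∈ S, 0 < s.1) (𝒜 : Automaton S Q) (k : ℤ) :
    PowerSeries.constantCoeff (𝒜.kernel.coeff k) = if k = 0 then 1 else 0 := by
  have hmem : 𝒜.kernel - 1 ∈ Ideal.span {(LaurentPolynomial.C (PowerSeries.X : R) : R[T;T⁻¹])} :=
    det_one_sub_sub_one_mem (adjacency_mem hS 𝒜)
  obtain ⟨g, hg⟩ := Ideal.mem_span_singleton.1 hmem
  rw [← LaurentPolynomial.smul_eq_C_mul, sub_eq_iff_eq_add, ← T_zero] at hg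
  rw [hg, AddMonoidAlgebra.coeff_add, AddMonoidAlgebra.coeff_smul, Finsupp.add_apply,
    Finsupp.smul_apply, T_apply]
  simp [eq_comm, apply_ite]

theorem coeff_mul_T (f : R[T;T⁻¹]) (n k : ℤ) : (f * T n).coeff k = f.coeff (k - n) := by
  have := AddMonoidAlgebra.coeff_mul_single_apply f (1 : R) n k
  simpa [sub_eq_add_neg] using this

theorem coeff_toLaurent_natCast (f : R[X]) (k : ℕ) :
    (Polynomial.toLaurent f).coeff k = f.coeff k := by
  rw [coeff_toLaurent]
  exact Finsupp.mapDomain_apply Nat.castEmbedding.injective _ _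

theorem exists_kernelPolynomial [Fintype Q] (hS : ∀ s ∈ S, 0 < s.1) (𝒜 : Automaton S Q) :
    ∃ (e : ℕ) (D : R[X]), Polynomial.toLaurent D = T (e : ℤ) * 𝒜.kernel ∧ D.eval 0 ≠ 0 ∧
      D.map PowerSeries.constantCoeff = Polynomial.X ^ e := by
  obtain ⟨n, p, hp⟩ := 𝒜.kernel.exists_T_pow
  have hK0 : 𝒜.kernel.coeff 0 ≠ 0 := by
    intro h
    have := constantCoeff_kernel hS 𝒜 0
    simp [h] at this
  have hp0 : p ≠ 0 := by
    rintro rfl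
    have h := coeff_mul_T 𝒜.kernel n n
    rw [← hp, map_zero, sub_self] at h
    exact hK0 h.symm
  obtain ⟨D, hpD, hD⟩ := Polynomial.exists_eq_pow_rootMultiplicity_mul_and_not_dvd p hp0 0
  rw [Polynomial.C_0, sub_zero] at hpD hD
  set j := p.rootMultiplicity 0
  have hDK : Polynomial.toLaurent D = 𝒜.kernel * T ((n : ℤ) - j) := by
    have := congrArg (fun f => f * T (-(j : ℤ))) hp
    rw [hpD, map_mul, Polynomial.toLaurent_X_pow, T_mul] at this
    rw [mul_assoc, mul_assoc, ← T_add, ← T_add, add_neg_cancel, T_zero, mul_one] at this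
    rw [this, sub_eq_add_neg]
  -- Otherwise the nonzero `u^0` coefficient of `K` would sit at the negative exponent `n - j` of
  -- the polynomial `D`.
  have hnj : (j : ℤ) ≤ n := by
    by_contra! hlt
    have h := coeff_mul_T 𝒜.kernel ((n : ℤ) - j) ((n : ℤ) - j)
    rw [← hDK, sub_self] at h
    refine hK0 (h.symm.trans ?_)
    rw [← Finsupp.notMem_support_iff, support_coeff_toLaurent, Finset.mem_map]
    rintro ⟨a, -, ha⟩
    simp at ha
    omega
  obtain ⟨e, he⟩ : ∃ e : ℕ, (e : ℤ) = (n : ℤ) - j := ⟨n - j, by omega⟩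
  rw [← he] at hDK
  refine ⟨e, D, by rw [hDK, T_mul], ?_, ?_⟩
  · rwa [Polynomial.X_dvd_iff, Polynomial.coeff_zero_eq_eval_zero] at hD
  · ext k
    rw [Polynomial.coeff_map, ← coeff_toLaurent_natCast, hDK, coeff_mul_T, constantCoeff_kernel hS,
      Polynomial.coeff_X_pow]
    simp [sub_eq_zero]

theorem exists_kernel_factorization [Fintype Q] (hS : ∀ s ∈ S, 0 < s.1) (𝒜 : Automaton S Q) :
    ∃ f q : R[X], Polynomial.toLaurent (f * q) = T (𝒜.numSmall : ℤ) * 𝒜.kernel ∧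
      (f * q).eval 0 ≠ 0 ∧ f.IsDistinguishedAt (IsLocalRing.maximalIdeal R) ∧
      𝒜.smallProd = f.map (algebraMap R L) := by
  obtain ⟨e, D, hD, hD0, hDmap⟩ := exists_kernelPolynomial hS 𝒜
  obtain ⟨f, q, rfl, hf, hfe, hq⟩ := exists_distinguished_mul hDmap
  have hroots := smallRoots_eq 𝒜 hD hD0 hf hq
  have hsplit := IsAlgClosed.splits (f.map (algebraMap R L))
  -- This identifies the exponent that clears the denominators of `K` with the number of small
  -- roots: both equal the degree of `f`.
  have hnum : 𝒜.numSmall = e := by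
    rw [Automaton.numSmall, hroots, ← hsplit.natDegree_eq_card_roots, hf.monic.natDegree_map, hfe]
  refine ⟨f, q, by rw [hnum, hD], hD0, hf, ?_⟩
  rw [Automaton.smallProd, hroots]
  exact (hsplit.eq_prod_roots_of_monic (hf.monic.map _)).symm

end

/-! ### Combinatorics of meanders -/

variable {S : Finset (ℤ × ℤ)} {Q : Type*}

theorem Automaton.run_concat {α Q : Type*} (𝒜 : Automaton α Q) (q : Q) (w : List α) (a : α) :
    𝒜.run q (w ++ [a]) = (𝒜.run q w).bind fun i => 𝒜.step i a := by
  induction w generalizing q with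
  | nil => simp [Automaton.run]
  | cons b w ih =>
    simp only [List.cons_append, Automaton.run, Option.bind_assoc]
    congr 1
    funext q'
    exact ih q'

theorem len_concat (w : Path S) (s : S) : len (w ++ [s]) = len w + s.1.1 := by simp [len]

theorem alt_concat (w : Path S) (s : S) : alt (w ++ [s]) = alt w + s.1.2 := by simp [alt]

theorem isMeander_concat (w : Path S) (s : S) :
    IsMeander (w ++ [s]) ↔ IsMeander w ∧ 0 ≤ alt (w ++ [s]) := by
  refine ⟨fun h => ⟨fun w' hw' => h w' (hw'.trans (List.prefix_append _ _)), h _ List.prefix_rfl⟩,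
    fun h w' hw' => ?_⟩
  rcases List.prefix_concat_iff.1 hw' with rfl | h'
  · exact h.2
  · exact h.1 w' h'

theorem isMeander_nil : IsMeander ([] : Path S) := by
  intro w' hw'
  rw [List.prefix_nil.1 hw']
  simp [alt]

theorem len_nonneg (hS : ∀ s ∈ S, 0 < s.1) (w : Path S) : 0 ≤ len w := by
  refine List.sum_nonneg fun x hx => ?_
  obtain ⟨s, -, rfl⟩ := List.mem_map.1 hx
  exact (hS s.1 s.2).le

/-- The meanders from the initial state to the state `q`, of length `n` and final altitude `k`. -/
def meandersTo (𝒜 : Automaton S Q) (q : Q) (n k : ℤ) : Set (Path S) :=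
  {w | 𝒜.run 𝒜.init w = some q ∧ IsMeander w ∧ len w = n ∧ alt w = k}

theorem finite_meandersTo (hS : ∀ s ∈ S, 0 < s.1) (𝒜 : Automaton S Q) (q : Q) (n k : ℤ) :
    (meandersTo 𝒜 q n k).Finite := by
  refine (finite_len_eq hS n.toNat).subset fun w hw => ?_
  have h1 := len_nonneg hS w
  have h2 := hw.2.2.1
  simp only [Set.mem_ofPred_eq]
  omega

theorem meandersTo_of_len_neg (hS : ∀ s ∈ S, 0 < s.1) (𝒜 : Automaton S Q) (q : Q) {n : ℤ}
    (hn : n < 0) (k : ℤ) : meandersTo 𝒜 q n k = ∅ := by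
  refine Set.eq_empty_of_forall_notMem fun w hw => ?_
  have h1 := len_nonneg hS w
  have h2 := hw.2.2.1
  omega

theorem meandersTo_of_alt_neg (𝒜 : Automaton S Q) (q : Q) (n : ℤ) {k : ℤ} (hk : k < 0) :
    meandersTo 𝒜 q n k = ∅ := by
  refine Set.eq_empty_of_forall_notMem fun w hw => ?_
  have h1 := hw.2.1 w List.prefix_rfl
  have h2 := hw.2.2.2
  omega

theorem concat_mem_meandersTo {𝒜 : Automaton S Q} {q : Q} {n k : ℤ} (hk : 0 ≤ k) {w : Path S}
    {s : S} : w ++ [s] ∈ meandersTo 𝒜 q n k ↔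
      ∃ i, 𝒜.step i s = some q ∧ w ∈ meandersTo 𝒜 i (n - s.1.1) (k - s.1.2) := by
  simp only [meandersTo, Set.mem_ofPred_eq, Automaton.run_concat, isMeander_concat, len_concat,
    alt_concat, Option.bind_eq_some_iff]
  constructor
  · rintro ⟨⟨i, hi, hs⟩, ⟨hm, -⟩, h1, h2⟩
    exact ⟨i, hs, hi, hm, by omega, by omega⟩
  · rintro ⟨i, hs, hi, hm, h1, h2⟩
    exact ⟨⟨i, hi, hs⟩, ⟨hm, by omega⟩, by omega, by omega⟩

/-! ### Laurent polynomials inside Laurent series -/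

theorem toSeries_T (n : ℤ) : toSeries (T n) = HahnSeries.single n 1 := by
  rw [toSeries, LaurentPolynomial.eval₂_T]
  rcases n with n | n
  · simp [HahnSeries.single_pow]
  · rw [zpow_negSucc, ← inv_pow, Units.val_pow_eq_pow_val]
    change (HahnSeries.single (-1 : ℤ) (1 : R)) ^ (n + 1) = _
    rw [HahnSeries.single_pow, one_pow, Int.negSucc_eq]
    congr 2
    simp

theorem toSeries_C_mul_T (r : R) (n : ℤ) :
    toSeries (LaurentPolynomial.C r * T n) = HahnSeries.single n r := by
  rw [map_mul, toSeries_T, toSeries, LaurentPolynomial.eval₂_C, HahnSeries.C_apply,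
    HahnSeries.single_mul_single, zero_add, mul_one]

theorem coeff_toSeries (f : R[T;T⁻¹]) (k : ℤ) : (toSeries f).coeff k = f.coeff k := by
  induction f using LaurentPolynomial.induction_on' with
  | add p q hp hq => rw [map_add, HahnSeries.coeff_add, hp, hq]; rfl
  | C_mul_T n a =>
    rw [toSeries_C_mul_T, ← LaurentPolynomial.smul_eq_C_mul, AddMonoidAlgebra.coeff_smul,
      Finsupp.smul_apply, T_apply, HahnSeries.coeff_single]
    simp [eq_comm]

theorem toSeries_toLaurent (p : R[X]) :
    toSeries (Polynomial.toLaurent p) = HahnSeries.ofPowerSeries ℤ R p := by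
  rw [toSeries, LaurentPolynomial.eval₂_toLaurent]
  induction p using Polynomial.induction_on' with
  | add p q hp hq => rw [Polynomial.eval₂_add, hp, hq, Polynomial.coe_add, map_add]
  | monomial n a =>
    rw [Polynomial.eval₂_monomial, ← Polynomial.C_mul_X_pow_eq_monomial, Polynomial.coe_mul,
      Polynomial.coe_pow, Polynomial.coe_C, Polynomial.coe_X, map_mul, map_pow,
      HahnSeries.ofPowerSeries_X, HahnSeries.ofPowerSeries_C]

theorem ofPowerSeries_map {A B : Type*} [CommRing A] [CommRing B] (φ : A →+* B)
    (h : PowerSeries A) : (HahnSeries.ofPowerSeries ℤ A h).map φ =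
      HahnSeries.ofPowerSeries ℤ B (PowerSeries.map φ h) := by
  ext k
  rw [HahnSeries.map_coeff, PowerSeries.coeff_coe, PowerSeries.coeff_coe, PowerSeries.coeff_map]
  split_ifs
  · exact map_zero φ
  · rfl

theorem exists_coe_eq_of_coeff_eq_zero {h : PowerSeries R} {N : ℕ}
    (hN : ∀ k, N ≤ k → PowerSeries.coeff k h = 0) : ∃ p : R[X], (p : PowerSeries R) = h := by
  refine ⟨PowerSeries.trunc N h, ?_⟩
  ext1 k
  rw [Polynomial.coeff_coe, PowerSeries.coeff_trunc]
  split_ifs with hk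
  · rfl
  · exact (hN k (not_lt.1 hk)).symm

theorem mem_range_toSeries {x : LaurentSeries R} (hx : ∀ k : ℤ, 0 < k → x.coeff k = 0) :
    x ∈ toSeries.range := by
  obtain ⟨p, hp⟩ := exists_coe_eq_of_coeff_eq_zero (h := x.powerSeriesPart)
    (N := (-x.order).toNat + 1) fun k hk => by
      rw [LaurentSeries.powerSeriesPart_coeff]
      exact hx _ (by omega)
  refine ⟨T x.order * Polynomial.toLaurent p, ?_⟩
  rw [map_mul, toSeries_T, toSeries_toLaurent, hp, LaurentSeries.single_order_mul_powerSeriesPart]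

theorem exists_coe_eq_of_mem_range {h : PowerSeries R}
    (hh : HahnSeries.ofPowerSeries ℤ R h ∈ toSeries.range) :
    ∃ p : R[X], (p : PowerSeries R) = h := by
  obtain ⟨g, hg⟩ := hh
  refine exists_coe_eq_of_coeff_eq_zero (N := (g.coeff.support.sup Int.toNat) + 1) fun k hk => ?_
  rw [← HahnSeries.ofPowerSeries_apply_coeff (Γ := ℤ), ← hg, coeff_toSeries]
  by_contra h0
  have := Finset.le_sup (f := Int.toNat) (Finsupp.mem_support_iff.2 h0)
  simp at this
  omega

/-! ### Generating functions and the functional equation -/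

theorem coeff_meanderGFAt (𝒜 : Automaton S Q) (q : Q) (k : ℤ) :
    (HahnSeries.ofPowerSeries ℤ R (𝒜.meanderGFAt q)).coeff k =
      PowerSeries.mk fun n => ((meandersTo 𝒜 q n k).ncard : ℂ) := by
  rcases lt_or_ge k 0 with hk | hk
  · have h := PowerSeries.coeff_coe (𝒜.meanderGFAt q) k
    rw [if_pos hk] at h
    refine h.trans ?_
    ext n
    simp [meandersTo_of_alt_neg 𝒜 q n hk]
  · lift k to ℕ using hk
    rw [HahnSeries.ofPowerSeries_apply_coeff, Automaton.meanderGFAt, PowerSeries.coeff_mk]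
    rfl

theorem excursionGF_eq (𝒜 : Automaton S Q) :
    𝒜.excursionGF = PowerSeries.constantCoeff 𝒜.meanderGF := by
  rw [← PowerSeries.coeff_zero_eq_constantCoeff_apply]
  ext n
  simp only [Automaton.excursionGF, Automaton.meanderGF, PowerSeries.coeff_mk]
  congr 2
  ext w
  simp only [IsExcursion, Set.mem_ofPred_eq, Nat.cast_zero]
  tauto

theorem meanderGF_eq_sum [Fintype Q] (hS : ∀ s ∈ S, 0 < s.1) (𝒜 : Automaton S Q) :
    𝒜.meanderGF = ∑ q, 𝒜.meanderGFAt q := by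
  ext k n
  rw [map_sum, map_sum]
  simp only [Automaton.meanderGF, Automaton.meanderGFAt, PowerSeries.coeff_mk]
  have h : {w : Path S | 𝒜.Accepts w ∧ IsMeander w ∧ len w = n ∧ alt w = k} =
      ⋃ q, meandersTo 𝒜 q n k := by
    ext w
    simp [meandersTo, Automaton.Accepts]
  rw [h, Set.ncard_iUnion_of_finite fun q => finite_meandersTo hS 𝒜 q n k,
    finsum_eq_sum_of_fintype, Nat.cast_sum]
  · rfl
  · exact fun q q' hq => Set.disjoint_left.2 fun w h h' =>
      hq (Option.some_injective _ (h.1.symm.trans h'.1))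

variable [Fintype Q] [DecidableEq Q]

/-- A meander is empty or has a unique last step. Conversely, appending a step keeps it a meander as
long as the new altitude is nonnegative, whence `hk`. -/
theorem ncard_meandersTo (hS : ∀ s ∈ S, 0 < s.1) (𝒜 : Automaton S Q) (j : Q) (n : ℤ) {k : ℤ}
    (hk : 0 ≤ k) :
    (meandersTo 𝒜 j n k).ncard = (if j = 𝒜.init ∧ n = 0 ∧ k = 0 then 1 else 0) +
      ∑ i, ∑ s : S, if 𝒜.step i s = some j then
        (meandersTo 𝒜 i (n - s.1.1) (k - s.1.2)).ncard else 0 := by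
  classical
  -- `none` indexes the empty path, `some (i, s)` the paths whose last step is `s`, read from state
  -- `i`. The pieces are disjoint because the automaton is deterministic.
  let B : Option (Q × S) → Set (Path S) := fun x => x.elim
    (if j = 𝒜.init ∧ n = 0 ∧ k = 0 then {[]} else ∅)
    (fun p => if 𝒜.step p.1 p.2 = some j then
      (fun w => w ++ [p.2]) '' meandersTo 𝒜 p.1 (n - p.2.1.1) (k - p.2.1.2) else ∅)
  have hB : meandersTo 𝒜 j n k = ⋃ x, B x := by
    ext w
    rw [Set.mem_iUnion]
    rcases List.eq_nil_or_concat w with rfl | ⟨w, s, rfl⟩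
    · have : ([] : Path S) ∈ meandersTo 𝒜 j n k ↔ j = 𝒜.init ∧ n = 0 ∧ k = 0 := by
        simp [meandersTo, Automaton.run, isMeander_nil, len, alt, eq_comm]
      rw [this, Option.exists]
      simp only [B, Option.elim]
      constructor
      · intro h
        left; simp [h]
      · rintro (h | ⟨p, h⟩)
        · by_contra h'
          simp [h'] at h
        · split_ifs at h <;> simp at h
    · rw [List.concat_eq_append, concat_mem_meandersTo hk, Option.exists]
      simp only [B, Option.elim]
      constructor
      · rintro ⟨i, hs, hw⟩
        right
        refine ⟨(i, s), ?_⟩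
        rw [if_pos hs]
        exact ⟨w, hw, rfl⟩
      · rintro (h | ⟨⟨i, s'⟩, h⟩)
        · split_ifs at h <;> simp at h
        · split_ifs at h with hs
          · obtain ⟨w', hw', he⟩ := h
            obtain ⟨rfl, he⟩ := List.append_inj' he rfl
            obtain rfl : s' = s := by simpa using he
            exact ⟨i, hs, hw'⟩
          · exact absurd h (Set.notMem_empty _)
  have hinj : ∀ s : S, Function.Injective fun w : Path S => w ++ [s] :=
    fun s => List.append_left_injective [s]
  have hfin : ∀ x, (B x).Finite := fun x =>
    (finite_meandersTo hS 𝒜 j n k).subset (hB ▸ Set.subset_iUnion B x)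
  have hdisj : Pairwise (Function.onFun Disjoint B) := by
    have key : ∀ x w, w ∈ B x → (x = none ∧ w = []) ∨
        ∃ i s w', x = some (i, s) ∧ w = w' ++ [s] ∧ 𝒜.run 𝒜.init w' = some i := by
      rintro (_ | ⟨i, s⟩) w hw <;> simp only [B, Option.elim] at hw <;> split_ifs at hw
      · exact Or.inl ⟨rfl, hw⟩
      · exact absurd hw (Set.notMem_empty _)
      · obtain ⟨w', hw', rfl⟩ := hw
        exact Or.inr ⟨i, s, w', rfl, rfl, hw'.1⟩
      · exact absurd hw (Set.notMem_empty _)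
    refine fun x y hxy => Set.disjoint_left.2 fun w hx hy => hxy ?_
    rcases key x w hx with ⟨rfl, rfl⟩ | ⟨i, s, w', rfl, rfl, hi⟩ <;>
      rcases key y _ hy with ⟨rfl, h⟩ | ⟨i', s', w'', rfl, h, hi'⟩
    · rfl
    · simp at h
    · simp at h
    · obtain ⟨rfl, he⟩ := List.append_inj' h rfl
      obtain rfl : s = s' := by simpa using he
      obtain rfl : i = i' := Option.some_injective _ (hi.symm.trans hi')
      rfl
  rw [hB, Set.ncard_iUnion_of_finite hfin hdisj, finsum_eq_sum_of_fintype,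
    Fintype.sum_option, Fintype.sum_prod_type]
  congr 1
  · simp only [B, Option.elim]
    split_ifs <;> simp
  · refine Finset.sum_congr rfl fun i _ => Finset.sum_congr rfl fun s _ => ?_
    simp only [B, Option.elim]
    split_ifs
    · exact Set.ncard_image_of_injective _ (hinj s)
    · simp

theorem coeff_sum_meanderGFAt_mul (hS : ∀ s ∈ S, 0 < s.1) (𝒜 : Automaton S Q) (j : Q) (k : ℤ)
    (n : ℕ) :
    PowerSeries.coeff n ((∑ i, HahnSeries.ofPowerSeries ℤ R (𝒜.meanderGFAt i) *
      toSeries (𝒜.adjacency i j)).coeff k) = ∑ i, ∑ s : S, if 𝒜.step i s = some j then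
        ((meandersTo 𝒜 i (n - s.1.1) (k - s.1.2)).ncard : ℂ) else 0 := by
  rw [HahnSeries.coeff_sum, map_sum]
  refine Finset.sum_congr rfl fun i _ => ?_
  rw [Automaton.adjacency, Matrix.of_apply, map_sum, Finset.mul_sum, HahnSeries.coeff_sum, map_sum]
  refine Finset.sum_congr rfl fun s _ => ?_
  split_ifs with h
  · rw [toSeries_C_mul_T, HahnSeries.coeff_mul_single, coeff_meanderGFAt, mul_comm,
      PowerSeries.coeff_X_pow_mul', PowerSeries.coeff_mk]
    have hs := hS s.1 s.2
    split_ifs with hn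
    · congr 3
      omega
    · rw [meandersTo_of_len_neg hS 𝒜 i (by omega)]
      simp
  · simp

/-- For `k < 0` the coefficient of `M_j` vanishes and both sides are minus that of `(M A)_j`; for `k
≥ 0` the truncation vanishes and the last-step recurrence applies. -/
theorem forbidden_eq (hS : ∀ s ∈ S, 0 < s.1) (𝒜 : Automaton S Q) (j : Q) :
    𝒜.forbidden j = ∑ i, HahnSeries.ofPowerSeries ℤ R (𝒜.meanderGFAt i) *
      toSeries ((1 - 𝒜.adjacency) i j) := by
  have hsum : ∑ i, HahnSeries.ofPowerSeries ℤ R (𝒜.meanderGFAt i) *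
      toSeries ((1 - 𝒜.adjacency) i j) = HahnSeries.ofPowerSeries ℤ R (𝒜.meanderGFAt j) -
        ∑ i, HahnSeries.ofPowerSeries ℤ R (𝒜.meanderGFAt i) * toSeries (𝒜.adjacency i j) := by
    simp only [Matrix.sub_apply, map_sub, mul_sub, Finset.sum_sub_distrib]
    congr 1
    simp [Matrix.one_apply, apply_ite]
  rw [hsum, Automaton.forbidden]
  set Y := ∑ i, HahnSeries.ofPowerSeries ℤ R (𝒜.meanderGFAt i) * toSeries (𝒜.adjacency i j) with hY
  ext k n
  rw [HahnSeries.coeff_sub, HahnSeries.coeff_sub, HahnSeries.coeff_truncLT, coeff_meanderGFAt]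
  have h1 : (if j = 𝒜.init then (1 : LaurentSeries R) else 0).coeff k =
      if j = 𝒜.init ∧ k = 0 then 1 else 0 := by
    split_ifs <;> simp_all [HahnSeries.coeff_one]
  rw [h1, map_sub, map_sub, PowerSeries.coeff_mk]
  split_ifs with h2 hk hk
  · omega
  · obtain ⟨h2, rfl⟩ := h2
    rw [hY, coeff_sum_meanderGFAt_mul hS, ncard_meandersTo hS 𝒜 j n le_rfl]
    push_cast
    simp [h2, PowerSeries.coeff_one]
  · simp [meandersTo_of_alt_neg 𝒜 j n hk]
  · rw [hY, coeff_sum_meanderGFAt_mul hS, ncard_meandersTo hS 𝒜 j n (not_lt.1 hk), if_neg (by tauto)]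
    push_cast
    simp

theorem forbidden_mem_range (𝒜 : Automaton S Q) (j : Q) : 𝒜.forbidden j ∈ toSeries.range := by
  refine mem_range_toSeries fun k hk => ?_
  rw [Automaton.forbidden, HahnSeries.coeff_sub, HahnSeries.coeff_truncLT, if_neg hk.not_gt]
  split_ifs <;> simp [HahnSeries.coeff_one, hk.ne']

theorem Phi_mem_range (𝒜 : Automaton S Q) : 𝒜.Phi ∈ toSeries.range := by
  rw [Automaton.Phi, ← toSeries_T]
  exact mul_mem ⟨_, rfl⟩ (sum_mem fun j _ => mul_mem (forbidden_mem_range 𝒜 j) ⟨_, rfl⟩)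

/-- From `F = M (I - A)` and `(I - A) adj(I - A) 1 = K 1`, the sum `F v` collapses to `K ∑ M_i`. -/
theorem Phi_eq (hS : ∀ s ∈ S, 0 < s.1) (𝒜 : Automaton S Q) {D : R[X]}
    (hD : Polynomial.toLaurent D = T (𝒜.numSmall : ℤ) * 𝒜.kernel) :
    𝒜.Phi = HahnSeries.ofPowerSeries ℤ R (D * 𝒜.meanderGF) := by
  have hv : ∀ i, ∑ j, (1 - 𝒜.adjacency) i j * 𝒜.autocorrelation j = 𝒜.kernel := by
    intro i
    have h : (1 - 𝒜.adjacency).mulVec 𝒜.autocorrelation = 𝒜.kernel • 1 := by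
      rw [Automaton.autocorrelation, Matrix.mulVec_mulVec, Matrix.mul_adjugate, Matrix.smul_mulVec,
        Matrix.one_mulVec, Automaton.kernel]
    have := congrFun h i
    simpa [Matrix.mulVec, dotProduct] using this
  have h2 : ∑ j, 𝒜.forbidden j * toSeries (𝒜.autocorrelation j) =
      HahnSeries.ofPowerSeries ℤ R 𝒜.meanderGF * toSeries 𝒜.kernel := by
    simp only [forbidden_eq hS, Finset.sum_mul]
    rw [Finset.sum_comm, meanderGF_eq_sum hS, map_sum, Finset.sum_mul]
    refine Finset.sum_congr rfl fun i _ => ?_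
    rw [← hv i, map_sum, Finset.mul_sum]
    refine Finset.sum_congr rfl fun j _ => ?_
    rw [map_mul, mul_assoc]
  rw [Automaton.Phi, h2, ← toSeries_T, map_mul, ← toSeries_toLaurent, hD, map_mul]
  ring

end LatticePath

end

/-! ### The theorem -/

open LatticePath in
theorem mainTheorem7 {Q : Type*} [Fintype Q] [DecidableEq Q]
    (S : Finset (ℤ × ℤ)) (hS : ∀ s ∈ S, 0 < s.1) (𝒜 : Automaton S Q) :
    𝒜.excursionGF = PowerSeries.constantCoeff 𝒜.meanderGF ∧
    (∃! G : Polynomial R, 𝒜.IsCofactor G) ∧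
    ∃ D : Polynomial R,
      Polynomial.toLaurent D = LaurentPolynomial.T (𝒜.numSmall : ℤ) * 𝒜.kernel ∧
      D.eval 0 ≠ 0 ∧
      ∀ G : Polynomial R, 𝒜.IsCofactor G →
        PowerSeries.map (algebraMap R L) 𝒜.meanderGF =
          ((G.map (algebraMap R L) * 𝒜.smallProd : Polynomial L) : PowerSeries L) *
            ((D.map (algebraMap R L) : Polynomial L) : PowerSeries L)⁻¹ ∧
        algebraMap R L 𝒜.excursionGF =
          (G.map (algebraMap R L) * 𝒜.smallProd).eval 0 / (D.map (algebraMap R L)).eval 0 := by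
  obtain ⟨f, q, hD, hD0, hf, hprod⟩ := exists_kernel_factorization hS 𝒜
  have hPhi := Phi_eq hS 𝒜 hD
  have inj := algebraMap_R_L_injective
  -- The small-root product is the image of `f`, so by injectivity of `R → L` the cofactor equation
  -- descends to `R`.
  have hcof : ∀ G : Polynomial R, 𝒜.IsCofactor G ↔
      ((f * q : Polynomial R) : PowerSeries R) * 𝒜.meanderGF =
        ((G * f : Polynomial R) : PowerSeries R) := by
    intro G
    rw [Automaton.IsCofactor, hPhi, hprod, ← Polynomial.map_mul, ofPowerSeries_map,
      HahnSeries.ofPowerSeries_injective.eq_iff, Polynomial.polynomial_map_coe,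
      (PowerSeries.map_injective _ inj).eq_iff]
  refine ⟨excursionGF_eq 𝒜, ?_, f * q, hD, hD0, fun G hG => ?_⟩
  · obtain ⟨p, hp⟩ := exists_coe_eq_of_mem_range (hPhi ▸ Phi_mem_range 𝒜)
    rw [Polynomial.coe_mul, mul_assoc] at hp
    obtain ⟨G, hG⟩ := exists_coe_eq_of_isDistinguishedAt (Ideal.IsPrime.ne_top inferInstance) hf hp
    refine ⟨G, (hcof G).2 ?_, fun G' hG' => ?_⟩
    · rw [Polynomial.coe_mul, Polynomial.coe_mul, mul_assoc, ← hG, mul_comm]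
    · have h := (hcof G').1 hG'
      rw [Polynomial.coe_mul, mul_assoc, ← hG, ← Polynomial.coe_mul, Polynomial.coe_inj,
        mul_comm] at h
      exact (mul_right_cancel₀ hf.monic.ne_zero h).symm
  · have h := congrArg (PowerSeries.map (algebraMap R L)) ((hcof G).1 hG)
    rw [map_mul, ← Polynomial.polynomial_map_coe, ← Polynomial.polynomial_map_coe,
      Polynomial.map_mul (p := G), ← hprod] at h
    have hD0' : ((f * q).map (algebraMap R L)).eval 0 ≠ 0 := by
      rw [Polynomial.eval_zero_map]
      exact (map_ne_zero_iff _ inj).2 hD0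
    have hc : ∀ p : Polynomial L, PowerSeries.constantCoeff (p : PowerSeries L) = p.eval 0 := by
      intro p
      rw [Polynomial.constantCoeff_coe, Polynomial.coeff_zero_eq_eval_zero]
    constructor
    -- The inverse in `L[[u]]` is a genuine one, since `D` does not vanish at `u = 0`.
    · rw [PowerSeries.eq_mul_inv_iff_mul_eq (by rwa [hc]), mul_comm]
      exact h
    · rw [eq_div_iff hD0', ← hc, ← hc, ← h, map_mul, mul_comm, excursionGF_eq]
      rfl
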